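/- Let $\mathcal X,\mathcal Y$ be finite sets, $n\ge 1$, and let $T=T_{XY}$ be a joint $n$-type on $\mathcal X\times\mathcal Y$, i.e. the empirical distribution of some sequence in $(\mathcal X\times\mathcal Y)^n$, with marginals $T_X,T_Y$. For an $m$-type $S$ let $\mathcal T^{(m)}_{S}$ be the set of sequences of length $m$ with empirical distribution $S$. For $m\ge1$ a multiple of $n$ (so that $T$ is also an $m$-type), the type graph of $T$ is the bipartite graph with vertex classes $\mathcal T^{(m)}_{T_X}$ and $\mathcal T^{(m)}_{T_Y}$ in which $\mathbf x,\mathbf y$ are adjacent iff $(\mathbf x,\mathbf y)\in\mathcal T^{(m)}_{T_{XY}}$. For $1\le M_1\le|\mathcal T^{(m)}_{T_X}|$ and $1\le M_2\le|\mathcal T^{(m)}_{T_Y}|$ put $$\Gamma_m(M_1,M_2)=\max\Big\{\tfrac{|(A\times B)\cap\mathcal T^{(m)}_{T_{XY}}|}{|A||B|}: A\subseteq\mathcal T^{(m)}_{T_X},\ B\subseteq\mathcal T^{(m)}_{T_Y},\ |A|=M_1,\ |B|=M_2\Big\}.$$ Let $\mathcal R_X^{(m)}=\{\frac1m\log M: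 1\le M\le|\mathcal T^{(m)}_{T_X}|\}$ and $\mathcal R_Y^{(m)}=\{\frac1m\log M: 1\le M\le|\mathcal T^{(m)}_{T_Y}|\}$ ($M$ integer, natural logarithm). The biclique rate region is $$\mathcal R_m(T)=\{(R_1,R_2)\in\mathcal R_X^{(m)}\times\mathcal R_Y^{(m)}:\Gamma_m(e^{mR_1},e^{mR_2})=1\},$$ and the asymptotic biclique rate region is $\mathcal R(T)=\mathrm{closure}\bigcup_{k\ge1}\mathcal R_{kn}(T)$. Let $$\mathcal R^*(T)=\bigcup_{\substack{0\le\alpha\le1,\ P_{XY},\,Q_{XY}:\\ \alpha P_{XY}+(1-\alpha)Q_{XY}=T_{XY}}}\big\{(R_1,R_2):0\le R_1\le\alpha H_P(X|Y),\ 0\le R_2\le(1-\alpha)H_Q(Y|X)\big\},$$ where $P_{XY},Q_{XY}$ are probability distributions on $\mathcal X\times\mathcal Y$ and $H$ denotes conditional Shannon entropy. For $A,B\subseteq\mathbb R^2$ let $A-B:=\bigcap_{b\in B}(A-b)$. Put $$\varepsilon_{1,n}=\frac{|\mathcal X||\mathcal Y|}{n}\log\frac{n^4(n+1)}{16|\mathcal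 X|},\qquad \varepsilon_{2,n}=\frac{|\mathcal X||\mathcal Y|}{n}\log\frac{n^4(n+1)}{16|\mathcal Y|^2}.$$ If $n\ge 8(|\mathcal X||\mathcal Y|)^{7/5}$, then $$\big(\mathcal R^*(T)-[0,\varepsilon_{1,n}]\times[0,\varepsilon_{2,n}]\big)\cap\big(\mathcal R_X^{(n)}\times\mathcal R_Y^{(n)}\big)\subseteq\mathcal R_n(T)\subseteq\mathcal R^*(T)\cap\big(\mathcal R_X^{(n)}\times\mathcal R_Y^{(n)}\big).$$ Moreover, for every $n\ge1$ and every joint $n$-type $T$, $\mathcal R(T)=\mathcal R^*(T)$. -/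

import Mathlib

namespace TypeGraph

noncomputable section

/-- The empirical distribution (type) of a sequence of length `n`. -/
def empirical {Z : Type*} (n : ℕ) (z : Fin n → Z) : Z → ℝ :=
  fun a => (Nat.card {i : Fin n // z i = a} : ℝ) / n

/-- `T` is an `n`-type on `Z`: the empirical distribution of some sequence of length `n`. -/
def IsType {Z : Type*} (n : ℕ) (T : Z → ℝ) : Prop :=
  ∃ z : Fin n → Z, empirical n z = T

open Classical in
/-- The type class of `T`: all sequences of length `n` whose type is `T`. -/
def typeClass {Z : Type*} [Fintype Z] (n : ℕ) (T : Z → ℝ) : Finset (Fin n → Z) :=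
  {z | empirical n z = T}

variable {X Y : Type*} [Fintype X] [Fintype Y]

/-- The marginal on the first coordinate. -/
def margX (P : X × Y → ℝ) : X → ℝ := fun x => ∑ y, P (x, y)

/-- The marginal on the second coordinate. -/
def margY (P : X × Y → ℝ) : Y → ℝ := fun y => ∑ x, P (x, y)

/-- Adjacency between the two sides of the type graph of `T`: the sequences `x` and `y` are joined
by an edge iff the pair sequence `(x, y)` lies in the joint type class of `T`.
The two vertex classes are `typeClass n (margX T)` and `typeClass n (margY T)`. -/
def Adj (n : ℕ) (T : X × Y → ℝ) (x : Fin n → X) (y : Fin n → Y) : Prop :=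
  (fun i => (x i, y i)) ∈ typeClass n T

open Classical in
/-- The edge density of the subgraph of the type graph of `T` induced by `A` and `B`. -/
def density (n : ℕ) (T : X × Y → ℝ) (A : Finset (Fin n → X)) (B : Finset (Fin n → Y)) : ℝ :=
  (((A ×ˢ B).filter fun p => Adj n T p.1 p.2).card : ℝ) / ((A.card : ℝ) * (B.card : ℝ))

/-- The maximal density `Γ_n(M₁, M₂)` of subgraphs of size `(M₁, M₂)`. For
`M₁ ≤ |typeClass n (margX T)|` and `M₂ ≤ |typeClass n (margY T)|` the supremum runs over a finite
nonempty set, so it is a maximum. -/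
def maxDensity (n : ℕ) (T : X × Y → ℝ) (M₁ M₂ : ℕ) : ℝ :=
  sSup {ρ : ℝ | ∃ A ⊆ typeClass n (margX T), ∃ B ⊆ typeClass n (margY T),
    A.card = M₁ ∧ B.card = M₂ ∧ density n T A B = ρ}

/-- The rates `(1/n) log M`, for `1 ≤ M ≤ |typeClass n P|`. -/
def rates {Z : Type*} [Fintype Z] (n : ℕ) (P : Z → ℝ) : Set ℝ :=
  {R | ∃ M : ℕ, 1 ≤ M ∧ M ≤ (typeClass n P).card ∧ R = Real.log M / n}

/-- The biclique rate region `R_n(T)`: the rate pairs `((1/n) log M₁, (1/n) log M₂)` for which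
the maximal density of subgraphs of size `(M₁, M₂)` is `1`. -/
def bicliqueRegion (n : ℕ) (T : X × Y → ℝ) : Set (ℝ × ℝ) :=
  {R | ∃ M₁ M₂ : ℕ, 1 ≤ M₁ ∧ M₁ ≤ (typeClass n (margX T)).card ∧
    1 ≤ M₂ ∧ M₂ ≤ (typeClass n (margY T)).card ∧
    R = (Real.log M₁ / n, Real.log M₂ / n) ∧ maxDensity n T M₁ M₂ = 1}

/-- The asymptotic biclique rate region of an `n`-type `T`, which is also a `kn`-type for all
`k ≥ 1`. -/
def asympBicliqueRegion (n : ℕ) (T : X × Y → ℝ) : Set (ℝ × ℝ) :=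
  closure (⋃ k : ℕ, ⋃ _ : 1 ≤ k, bicliqueRegion (k * n) T)

/-- Shannon entropy (natural logarithm). -/
def entropy {Z : Type*} [Fintype Z] (P : Z → ℝ) : ℝ := ∑ a, Real.negMulLog (P a)

/-- `H_P(X|Y) = H_P(X,Y) - H_P(Y)`. -/
def condEntropyXY (P : X × Y → ℝ) : ℝ := entropy P - entropy (margY P)

/-- `H_P(Y|X) = H_P(X,Y) - H_P(X)`. -/
def condEntropyYX (P : X × Y → ℝ) : ℝ := entropy P - entropy (margX P)

/-- The region `R*(T)` of pairs of (nonnegative) rates. -/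
def regionStar (T : X × Y → ℝ) : Set (ℝ × ℝ) :=
  {R | 0 ≤ R.1 ∧ 0 ≤ R.2 ∧ ∃ α : ℝ, 0 ≤ α ∧ α ≤ 1 ∧
    ∃ P ∈ stdSimplex ℝ (X × Y), ∃ Q ∈ stdSimplex ℝ (X × Y),
      α • P + (1 - α) • Q = T ∧
      R.1 ≤ α * condEntropyXY P ∧ R.2 ≤ (1 - α) * condEntropyYX Q}

/-- The Minkowski difference `⋂ b ∈ B, (A - b)`. -/
def minkowskiDiff (A B : Set (ℝ × ℝ)) : Set (ℝ × ℝ) :=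
  ⋂ b ∈ B, {r | r + b ∈ A}

/-- The margin `ε_{1,n}`, for alphabets of sizes `a = |X|` and `b = |Y|`. -/
def eps₁ (a b n : ℕ) : ℝ :=
  (a : ℝ) * b / n * Real.log ((n : ℝ) ^ 4 * (n + 1) / (16 * a))

/-- The margin `ε_{2,n}`, for alphabets of sizes `a = |X|` and `b = |Y|`. -/
def eps₂ (a b n : ℕ) : ℝ :=
  (a : ℝ) * b / n * Real.log ((n : ℝ) ^ 4 * (n + 1) / (16 * (b : ℝ) ^ 2))

end

end TypeGraph

/-!
The conditional entropy `H(X|Y) = H(X, Y) - H(Y)` extends to unnormalised mass functions, where it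
is homogeneous of degree one (`condEntropyXY_smul`). A point of `R*(T)` is therefore the same
thing as a splitting of the count function `n T` into two nonnegative parts `S` and `S'`, the
rates being bounded by the conditional entropies of `S` and `S'`.

*Every biclique lies in `R*(T)`* (`biclique_mem_regionStar`, without error term). If `A × B` is a
biclique, the numbers `⟨1_{x = a}, 1_{y = b}⟩ = n T (a, b)` do not depend on `x ∈ A` and `y ∈ B`,
so the differences of indicator vectors coming from `A` are orthogonal to those coming from `B`.
For any subspace of `ℝⁿ` there is a set `J` of coordinates that determines its vectors, while the
complement of `J` determines the vectors orthogonal to it (`exists_determining_coords`); so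
elements of `A` are determined by their letters in `J`, those of `B` by their letters outside `J`.
For independent uniform elements of `A` and `B`, subadditivity of entropy bounds `log |A|` by the
sum over `J` of the one-letter entropies (`log_card_le_sum_entropy`), and the concavity of entropy
bounds that sum by the conditional entropy of the sum `S` over `J` of the one-position joint
distributions (`sum_entropy_le_condEntropyXY`). The other side gives `S'` from the complement of
`J`, and `S + S'` is the expected count function, `n T`.

*Points of `R*(T)` are nearly bicliques* (`exists_biclique`). Round the first part of the
splitting down and the second up, so that both are integral, and take a set `J` of positions of a
sequence `(x, y)` of type `T` with the letter counts of the first part. Permuting `x` inside `J`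
along `y`, and `y` outside `J` along `x`, gives a biclique, as the two permutations combine into a
single permutation of `(x, y)`. The orbit–stabiliser theorem counts its sides by products of
factorials, and crude Stirling bounds turn these into conditional entropies, with a loss of at
most `|X| |Y| (3 + 2 log n)`. The margins in the theorem exceed this divided by `n`
(`loss_le_margin`), and it is `o(n)`; together with the closedness of `R*(T)`
(`isClosed_regionStar`) this gives the asymptotic region.
-/

namespace TypeGraph

open Finset

noncomputable section

variable {X Y Z : Type*}

/-! ### Conditional entropy as a homogeneous function -/

lemma entropy_smul [Fintype Z] (c : ℝ) (P : Z → ℝ) :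
    entropy (c • P) = (∑ a, P a) * Real.negMulLog c + c * entropy P := by
  simp [entropy, Real.negMulLog_mul, sum_add_distrib, sum_mul, mul_sum]

lemma margY_smul [Fintype X] (c : ℝ) (P : X × Y → ℝ) : margY (c • P) = c • margY P := by
  ext y; simp [margY, mul_sum]

lemma sum_margY [Fintype X] [Fintype Y] (P : X × Y → ℝ) : ∑ y, margY P y = ∑ z, P z :=
  (Fintype.sum_prod_type_right P).symm

/-- On unnormalised mass functions the conditional entropy is homogeneous of degree one. This is
what allows all estimates to be carried out with counts instead of probabilities. -/
lemma condEntropyXY_smul [Fintype X] [Fintype Y] (c : ℝ) (P : X × Y → ℝ) :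
    condEntropyXY (c • P) = c * condEntropyXY P := by
  rw [condEntropyXY, margY_smul, entropy_smul, entropy_smul, sum_margY, condEntropyXY]
  ring

lemma condEntropyYX_eq_swap [Fintype X] [Fintype Y] (P : X × Y → ℝ) :
    condEntropyYX P = condEntropyXY (P ∘ Prod.swap) := by
  have h : entropy (P ∘ Prod.swap) = entropy P :=
    (Equiv.prodComm Y X).sum_comp fun a => Real.negMulLog (P a)
  rw [condEntropyXY, h]
  rfl

lemma condEntropyYX_smul [Fintype X] [Fintype Y] (c : ℝ) (P : X × Y → ℝ) :
    condEntropyYX (c • P) = c * condEntropyYX P := by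
  rw [condEntropyYX_eq_swap, condEntropyYX_eq_swap, ← condEntropyXY_smul]
  rfl

lemma condEntropyXY_eq_sum [Fintype X] [Fintype Y] (P : X × Y → ℝ) :
    condEntropyXY P =
      ∑ y, ((∑ x, Real.negMulLog (P (x, y))) - Real.negMulLog (margY P y)) := by
  rw [condEntropyXY, entropy, entropy, Fintype.sum_prod_type_right, sum_sub_distrib]

/-! ### Types -/

lemma IsType.mem_stdSimplex [Fintype Z] {n : ℕ} (hn : 1 ≤ n) {T : Z → ℝ} (hT : IsType n T) :
    T ∈ stdSimplex ℝ Z := by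
  classical
  obtain ⟨z, rfl⟩ := hT
  refine ⟨fun a => by unfold empirical; positivity, ?_⟩
  have h : ∑ a, Nat.card {i : Fin n // z i = a} = n := by
    simp only [Nat.card_eq_fintype_card, Fintype.card_subtype]
    simpa using (card_eq_sum_card_fiberwise (f := z) (s := univ) (t := univ) (by simp)).symm
  have hn' : (n : ℝ) ≠ 0 := by positivity
  simp only [empirical]
  rw [← sum_div, ← Nat.cast_sum, h, div_self hn']

lemma mem_typeClass [Fintype Z] {n : ℕ} {T : Z → ℝ} {z : Fin n → Z} :
    z ∈ typeClass n T ↔ empirical n z = T := by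
  simp [typeClass]

lemma empirical_fst [Fintype Y] {n : ℕ} (x : Fin n → X) (y : Fin n → Y) :
    empirical n x = margX (empirical n fun i => (x i, y i)) := by
  classical
  ext a
  simp only [margX, empirical, Nat.card_eq_fintype_card, Fintype.card_subtype, Prod.mk.injEq]
  rw [← sum_div, ← Nat.cast_sum]
  congr 2
  rw [card_eq_sum_card_fiberwise (f := y) (t := univ) (by simp)]
  simp only [filter_filter]

lemma empirical_snd [Fintype X] {n : ℕ} (x : Fin n → X) (y : Fin n → Y) :
    empirical n y = margY (empirical n fun i => (x i, y i)) := by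
  classical
  ext b
  simp only [margY, empirical, Nat.card_eq_fintype_card, Fintype.card_subtype, Prod.mk.injEq]
  rw [← sum_div, ← Nat.cast_sum]
  congr 2
  rw [card_eq_sum_card_fiberwise (f := x) (t := univ) (by simp)]
  simp only [filter_filter, and_comm]

open Classical in
/-- The joint letter counts of two sequences are inner products of indicator vectors. -/
lemma sum_ite_mul_ite {n : ℕ} (hn : 1 ≤ n) (x : Fin n → X) (y : Fin n → Y) (a : X) (b : Y) :
    ∑ i, ((if x i = a then 1 else 0) * (if y i = b then 1 else 0) : ℝ) =
      n * empirical n (fun i => (x i, y i)) (a, b) := by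
  have hn' : (n : ℝ) ≠ 0 := by positivity
  simp only [empirical, Nat.card_eq_fintype_card, Fintype.card_subtype, Prod.mk.injEq]
  rw [mul_div_cancel₀ _ hn', card_eq_sum_ones, sum_filter]
  push_cast
  refine sum_congr rfl fun i _ => ?_
  by_cases h1 : x i = a <;> by_cases h2 : y i = b <;> simp [h1, h2]

/-! ### Complementary sets of determining coordinates -/

/-- The coordinate functionals restricted to `V` contain a basis of the dual of `V`, indexed by
some set `J` of coordinates. Spanning says that vectors of `V` are determined by their coordinates
in `J`; linear independence says that vectors orthogonal to `V` are determined by their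
coordinates outside `J`. -/
lemma exists_determining_coords {ι : Type*} [Fintype ι] (V : Submodule ℝ (ι → ℝ)) :
    ∃ J : Finset ι, (∀ v ∈ V, (∀ j ∈ J, v j = 0) → v = 0) ∧
      ∀ w : ι → ℝ, (∀ v ∈ V, ∑ i, v i * w i = 0) → (∀ j ∉ J, w j = 0) → w = 0 := by
  classical
  let f : ι → Module.Dual ℝ V := fun i => (LinearMap.proj i).comp V.subtype
  obtain ⟨κ, a, ha, hspan, hli⟩ := exists_linearIndependent' ℝ f
  have : Fintype κ := Fintype.ofInjective a ha
  refine ⟨univ.image a, fun v hv h => ?_, fun w hw h => ?_⟩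
  · have key : ∀ g ∈ Submodule.span ℝ (Set.range (f ∘ a)), g ⟨v, hv⟩ = 0 := by
      intro g hg
      induction hg using Submodule.span_induction with
      | mem g hg =>
        obtain ⟨k, rfl⟩ := hg
        exact h (a k) (mem_image_of_mem _ (mem_univ k))
      | zero => rfl
      | add g g' _ _ hg hg' => simp [hg, hg']
      | smul c g _ hg => simp [hg]
    ext i
    exact key (f i) (hspan ▸ Submodule.subset_span ⟨i, rfl⟩)
  · have h0 : ∑ k, w (a k) • (f ∘ a) k = 0 := by
      ext ⟨v, hv⟩
      have h1 := hw v hv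
      rw [← sum_subset (subset_univ (univ.image a))
        (fun i _ hi => by rw [h i hi, mul_zero]), sum_image ha.injOn] at h1
      simpa [f, mul_comm] using h1
    have h2 := Fintype.linearIndependent_iff.1 hli (fun k => w (a k)) h0
    ext i
    by_cases hi : i ∈ univ.image a
    · obtain ⟨k, -, rfl⟩ := mem_image.1 hi
      exact h2 k
    · exact h i hi

/-- If `A × B` is a biclique in the type graph, then some set `J` of positions is such that the
elements of `A` are determined by their letters in `J` and the elements of `B` by their letters
outside `J`. -/
lemma exists_determining_positions {n : ℕ} (hn : 1 ≤ n) {T : X × Y → ℝ} {A : Finset (Fin n → X)}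
    {B : Finset (Fin n → Y)}
    (hAB : ∀ x ∈ A, ∀ y ∈ B, empirical n (fun i => (x i, y i)) = T) :
    ∃ J : Finset (Fin n), (∀ x ∈ A, ∀ x' ∈ A, (∀ j ∈ J, x j = x' j) → x = x') ∧
      ∀ y ∈ B, ∀ y' ∈ B, (∀ j ∉ J, y j = y' j) → y = y' := by
  classical
  let e (x : Fin n → X) (a : X) : Fin n → ℝ := fun i => if x i = a then 1 else 0
  let f (y : Fin n → Y) (b : Y) : Fin n → ℝ := fun i => if y i = b then 1 else 0
  have hef : ∀ x ∈ A, ∀ y ∈ B, ∀ a b, ∑ i, e x a i * f y b i = n * T (a, b) := by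
    intro x hx y hy a b
    rw [← hAB x hx y hy]
    exact sum_ite_mul_ite hn x y a b
  obtain ⟨J, hJ, hJ'⟩ := exists_determining_coords
    (Submodule.span ℝ {v | ∃ x ∈ A, ∃ x' ∈ A, ∃ a, v = e x a - e x' a})
  refine ⟨J, fun x hx x' hx' h => ?_, fun y hy y' hy' h => ?_⟩
  · ext i
    have := hJ _ (Submodule.subset_span ⟨x, hx, x', hx', x i, rfl⟩)
      (fun j hj => by simp [e, h j hj])
    have := congrFun this i
    by_contra hne
    simp [e, Ne.symm hne] at this
  · ext i
    have := hJ' (f y (y i) - f y' (y i)) (fun v hv => ?_) (fun j hj => by simp [f, h j hj])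
    · have := congrFun this i
      by_contra hne
      simp [f, Ne.symm hne] at this
    · induction hv using Submodule.span_induction with
      | mem v hv =>
        obtain ⟨x, hx, x', hx', a, rfl⟩ := hv
        simp only [Pi.sub_apply, sub_mul, mul_sub, sum_sub_distrib]
        rw [hef x hx y hy, hef x hx y' hy', hef x' hx' y hy, hef x' hx' y' hy']
        ring
      | zero => simp
      | add v w _ _ hv hw =>
        simp only [Pi.add_apply, add_mul, sum_add_distrib, hv, hw, add_zero]
      | smul c v _ hv => simp only [Pi.smul_apply, smul_eq_mul, mul_assoc, ← mul_sum, hv, mul_zero]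

/-! ### Single-letter entropy bounds for a biclique -/

open Classical in
/-- The distribution of the `i`-th letter of a uniformly random element of `A`. -/
def letterDist {n : ℕ} (A : Finset (Fin n → Z)) (i : Fin n) (a : Z) : ℝ :=
  (#{x ∈ A | x i = a} : ℝ) / #A

lemma letterDist_nonneg {n : ℕ} (A : Finset (Fin n → Z)) (i : Fin n) (a : Z) :
    0 ≤ letterDist A i a := by
  unfold letterDist; positivity

lemma card_mul_letterDist [Fintype Z] {n : ℕ} (A : Finset (Fin n → Z)) (i : Fin n) (g : Z → ℝ) :
    #A * ∑ a, letterDist A i a * g a = ∑ x ∈ A, g (x i) := by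
  classical
  rcases A.eq_empty_or_nonempty with rfl | hA
  · simp
  have hA' : (#A : ℝ) ≠ 0 := by positivity
  rw [mul_sum, ← sum_fiberwise_of_maps_to (g := fun x : Fin n → Z => x i) (t := univ)
    (fun _ _ => mem_univ _)]
  refine sum_congr rfl fun a _ => ?_
  rw [sum_congr rfl (g := fun _ => g a) (fun x hx => by rw [(mem_filter.1 hx).2]), sum_const,
    nsmul_eq_mul, letterDist, ← mul_assoc, mul_div_cancel₀ _ hA']

lemma sum_letterDist [Fintype Z] {n : ℕ} {A : Finset (Fin n → Z)} (hA : A.Nonempty) (i : Fin n) :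
    ∑ a, letterDist A i a = 1 := by
  have h := card_mul_letterDist A i (fun _ => 1)
  have hA' : (#A : ℝ) ≠ 0 := by positivity
  simpa [hA'] using h

/-- Subadditivity of entropy for the uniform distribution on `A`: compare it with the product of
its one-letter marginals over `J`, using `log t ≤ t - 1`. -/
lemma log_card_le_sum_entropy [Fintype Z] {n : ℕ} {A : Finset (Fin n → Z)} (hA : A.Nonempty)
    {J : Finset (Fin n)} (hJ : ∀ x ∈ A, ∀ x' ∈ A, (∀ j ∈ J, x j = x' j) → x = x') :
    Real.log #A ≤ ∑ j ∈ J, entropy (letterDist A j) := by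
  classical
  have hA' : (0 : ℝ) < #A := by positivity
  have hpos : ∀ x ∈ A, ∀ j, 0 < letterDist A j (x j) := by
    intro x hx j
    have : 0 < #{x' ∈ A | x' j = x j} := card_pos.2 ⟨x, by simp [hx]⟩
    unfold letterDist; positivity
  have hq : ∑ x ∈ A, ∏ j ∈ J, letterDist A j (x j) ≤ 1 := by
    let r : (Fin n → Z) → (J → Z) := fun x j => x j
    have hr : Set.InjOn r A := fun x hx x' hx' h =>
      hJ x hx x' hx' fun j hj => congrFun h ⟨j, hj⟩
    calc ∑ x ∈ A, ∏ j ∈ J, letterDist A j (x j)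
        = ∑ w ∈ A.image r, ∏ j : J, letterDist A j (w j) := by
          rw [sum_image hr]
          exact sum_congr rfl fun x _ =>
            (prod_coe_sort J fun j => letterDist A j (x j)).symm
      _ ≤ ∑ w : J → Z, ∏ j : J, letterDist A j (w j) :=
          sum_le_sum_of_subset_of_nonneg (subset_univ _)
            fun w _ _ => prod_nonneg fun j _ => letterDist_nonneg _ _ _
      _ = ∏ j : J, ∑ a, letterDist A j a := by
          rw [prod_univ_sum, Fintype.piFinset_univ]
      _ = 1 := by simp [sum_letterDist hA]
  have hlog : ∑ x ∈ A, Real.log (#A * ∏ j ∈ J, letterDist A j (x j)) ≤ 0 := by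
    calc ∑ x ∈ A, Real.log (#A * ∏ j ∈ J, letterDist A j (x j))
        ≤ ∑ x ∈ A, (#A * ∏ j ∈ J, letterDist A j (x j) - 1) :=
          sum_le_sum fun x hx => Real.log_le_sub_one_of_pos
            (mul_pos hA' (prod_pos fun j _ => hpos x hx j))
      _ = #A * (∑ x ∈ A, ∏ j ∈ J, letterDist A j (x j) - 1) := by
          rw [sum_sub_distrib, ← mul_sum]; simp; ring
      _ ≤ 0 := mul_nonpos_of_nonneg_of_nonpos hA'.le (by linarith)
  have hsum : ∑ x ∈ A, Real.log (#A * ∏ j ∈ J, letterDist A j (x j)) =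
      #A * (Real.log #A - ∑ j ∈ J, entropy (letterDist A j)) := by
    rw [sum_congr rfl fun x hx => by
      rw [Real.log_mul hA'.ne' (prod_pos fun j _ => hpos x hx j).ne',
        Real.log_prod (fun j _ => (hpos x hx j).ne')], sum_add_distrib, sum_comm]
    rw [sum_congr rfl fun j _ =>
      (card_mul_letterDist A j fun a => Real.log (letterDist A j a)).symm]
    simp [entropy, Real.negMulLog, mul_add, mul_sum]
  rw [hsum] at hlog
  have := nonpos_of_mul_nonpos_right hlog hA'
  linarith

/-- For probability vectors `p j` and `r j`, the total entropy of the `p j` is at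
most the conditional entropy of the sum of the products `p j ⊗ r j`: the index `j` separates
the two letters, so that conditioning on the second letter in place of `j` only increases the
entropy of the first. -/
lemma sum_entropy_le_condEntropyXY [Fintype X] [Fintype Y] {ι : Type*} (J : Finset ι)
    {p : ι → X → ℝ} {r : ι → Y → ℝ}
    (hp : ∀ j a, 0 ≤ p j a) (hp1 : ∀ j, ∑ a, p j a = 1)
    (hr : ∀ j b, 0 ≤ r j b) (hr1 : ∀ j, ∑ b, r j b = 1) :
    ∑ j ∈ J, entropy (p j) ≤ condEntropyXY fun z => ∑ j ∈ J, p j z.1 * r j z.2 := by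
  set S : X × Y → ℝ := fun z => ∑ j ∈ J, p j z.1 * r j z.2 with hS
  have hmarg : ∀ b, margY S b = ∑ j ∈ J, r j b := by
    intro b
    simp only [margY, hS]
    rw [sum_comm]
    exact sum_congr rfl fun j _ => by rw [← sum_mul, hp1, one_mul]
  have hletter : ∀ a b, ∑ j ∈ J, r j b * Real.negMulLog (p j a) ≤
      Real.negMulLog (S (a, b)) + S (a, b) * Real.log (margY S b) := by
    intro a b
    have hterm : ∀ j ∈ J, 0 ≤ p j a * r j b := fun j _ => mul_nonneg (hp j a) (hr j b)
    rcases (sum_nonneg hterm).eq_or_lt with h0 | h0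
    · have hz := (sum_eq_zero_iff_of_nonneg hterm).1 h0.symm
      have hS0 : S (a, b) = 0 := h0.symm
      rw [hS0, sum_eq_zero]
      · simp
      · intro j hj
        rcases mul_eq_zero.1 (hz j hj) with h | h <;> simp [h]
    · have hS0 : 0 < S (a, b) := h0
      have hle : S (a, b) ≤ margY S b :=
        single_le_sum (f := fun x => S (x, b))
          (fun x _ => sum_nonneg fun j _ => mul_nonneg (hp j x) (hr j b)) (mem_univ a)
      have hM : 0 < margY S b := hS0.trans_le hle
      set c := S (a, b) / margY S b with hc
      have hcpos : 0 < c := div_pos hS0 hM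
      -- tangent line of `t ↦ -t log t` at the conditional probability `c`
      have htan : ∀ t, 0 ≤ t → Real.negMulLog t ≤ -t * Real.log c + c - t := by
        intro t ht
        rcases ht.eq_or_lt with rfl | ht
        · simpa using hcpos.le
        · have := Real.log_le_sub_one_of_pos (div_pos hcpos ht)
          rw [Real.log_div hcpos.ne' ht.ne'] at this
          have h2 := mul_le_mul_of_nonneg_left this ht.le
          have h3 : t * (c / t - 1) = c - t := by field_simp
          rw [Real.negMulLog]
          nlinarith
      calc ∑ j ∈ J, r j b * Real.negMulLog (p j a)
          ≤ ∑ j ∈ J, r j b * (-p j a * Real.log c + c - p j a) :=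
            sum_le_sum fun j _ => mul_le_mul_of_nonneg_left (htan _ (hp j a)) (hr j b)
        _ = -(Real.log c) * S (a, b) + c * margY S b - S (a, b) := by
            rw [hmarg]
            simp only [hS, mul_sum, ← sum_add_distrib, ← sum_sub_distrib]
            exact sum_congr rfl fun j _ => by ring
        _ = Real.negMulLog (S (a, b)) + S (a, b) * Real.log (margY S b) := by
            rw [hc, Real.log_div hS0.ne' hM.ne', div_mul_cancel₀ _ hM.ne', Real.negMulLog]
            ring
  calc ∑ j ∈ J, entropy (p j)
      = ∑ b, ∑ a, ∑ j ∈ J, r j b * Real.negMulLog (p j a) := by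
        rw [sum_congr rfl fun b _ => sum_comm, sum_comm]
        refine sum_congr rfl fun j _ => ?_
        simp only [← mul_sum]
        rw [← sum_mul, hr1, one_mul]
        rfl
    _ ≤ ∑ b, ∑ a, (Real.negMulLog (S (a, b)) + S (a, b) * Real.log (margY S b)) :=
        sum_le_sum fun b _ => sum_le_sum fun a _ => hletter a b
    _ = condEntropyXY S := by
        rw [condEntropyXY_eq_sum]
        refine sum_congr rfl fun b _ => ?_
        rw [sum_add_distrib, ← sum_mul]
        simp [Real.negMulLog, margY]

/-- A splitting of `n T` into two unnormalised mass functions yields a point of the region. -/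
lemma mem_regionStar_of_add [Fintype X] [Fintype Y] {n : ℕ} (hn : 1 ≤ n)
    {T : X × Y → ℝ} (hT : T ∈ stdSimplex ℝ (X × Y))
    {S S' : X × Y → ℝ} (hS : ∀ z, 0 ≤ S z) (hS' : ∀ z, 0 ≤ S' z)
    (hadd : ∀ z, S z + S' z = n * T z) {R : ℝ × ℝ} (h1 : 0 ≤ R.1) (h2 : 0 ≤ R.2)
    (hR1 : n * R.1 ≤ condEntropyXY S) (hR2 : n * R.2 ≤ condEntropyYX S') :
    R ∈ regionStar T := by
  have hn' : (0 : ℝ) < n := by positivity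
  -- any mass function is its total mass times a probability vector
  have hnorm : ∀ U : X × Y → ℝ, (∀ z, 0 ≤ U z) →
      ∃ P ∈ stdSimplex ℝ (X × Y), (∑ z, U z) • P = U := by
    intro U hU
    rcases (sum_nonneg fun z (_ : z ∈ univ) => hU z).eq_or_lt with h0 | h0
    · refine ⟨T, hT, ?_⟩
      have := (sum_eq_zero_iff_of_nonneg fun z (_ : z ∈ univ) => hU z).1 h0.symm
      ext z
      simp [← h0, this z (mem_univ z)]
    · refine ⟨(∑ z, U z)⁻¹ • U, ⟨fun z => mul_nonneg (inv_nonneg.2 h0.le) (hU z), ?_⟩, ?_⟩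
      · simp only [Pi.smul_apply, smul_eq_mul, ← mul_sum]
        exact inv_mul_cancel₀ h0.ne'
      · rw [smul_smul, mul_inv_cancel₀ h0.ne', one_smul]
  have htot : ∑ z, S z + ∑ z, S' z = n := by
    rw [← sum_add_distrib, sum_congr rfl fun z _ => hadd z, ← mul_sum, hT.2, mul_one]
  obtain ⟨P, hP, hPS⟩ := hnorm S hS
  obtain ⟨Q, hQ, hQS⟩ := hnorm S' hS'
  have hs := sum_nonneg fun z (_ : z ∈ univ) => hS z
  have hs' := sum_nonneg fun z (_ : z ∈ univ) => hS' z
  have hα : 1 - (∑ z, S z) / n = (∑ z, S' z) / n := by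
    rw [eq_div_iff hn'.ne', sub_mul, div_mul_cancel₀ _ hn'.ne']
    linarith
  refine ⟨h1, h2, (∑ z, S z) / n, by positivity, ?_, P, hP, Q, hQ, ?_, ?_, ?_⟩
  · rw [div_le_one hn']; linarith
  · rw [hα, div_eq_inv_mul, div_eq_inv_mul, mul_smul, mul_smul, hPS, hQS, ← smul_add]
    ext z
    simp only [Pi.smul_apply, Pi.add_apply, hadd, smul_eq_mul]
    exact inv_mul_cancel_left₀ hn'.ne' _
  · rw [div_mul_eq_mul_div, ← condEntropyXY_smul, hPS, le_div_iff₀ hn', mul_comm]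
    exact hR1
  · rw [hα, div_mul_eq_mul_div, ← condEntropyYX_smul, hQS, le_div_iff₀ hn', mul_comm]
    exact hR2

/-- The converse: the rate pair of every biclique lies in the region `R*(T)`. -/
lemma biclique_mem_regionStar [Fintype X] [Fintype Y] {n : ℕ} (hn : 1 ≤ n) {T : X × Y → ℝ}
    {A : Finset (Fin n → X)}
    {B : Finset (Fin n → Y)} (hA : A.Nonempty) (hB : B.Nonempty)
    (hAB : ∀ x ∈ A, ∀ y ∈ B, empirical n (fun i => (x i, y i)) = T) :
    (Real.log #A / n, Real.log #B / n) ∈ regionStar T := by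
  classical
  have hn' : (n : ℝ) ≠ 0 := by positivity
  have hT : T ∈ stdSimplex ℝ (X × Y) := by
    obtain ⟨x, hx⟩ := hA
    obtain ⟨y, hy⟩ := hB
    exact IsType.mem_stdSimplex hn ⟨_, hAB x hx y hy⟩
  obtain ⟨J, hJA, hJB⟩ := exists_determining_positions hn hAB
  have hprod : ∀ a b, ∑ i, letterDist A i a * letterDist B i b = n * T (a, b) := by
    intro a b
    have hA' : (#A : ℝ) ≠ 0 := by positivity
    have hB' : (#B : ℝ) ≠ 0 := by positivity
    have hcount : ∑ i, (#{x ∈ A | x i = a} : ℝ) * #{y ∈ B | y i = b} =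
        #A * #B * (n * T (a, b)) := by
      have h1 : ∀ x ∈ A, ∀ y ∈ B,
          ∑ i, ((if x i = a then 1 else 0) * (if y i = b then 1 else 0) : ℝ) = n * T (a, b) := by
        intro x hx y hy
        rw [← hAB x hx y hy]
        exact sum_ite_mul_ite hn x y a b
      calc ∑ i, (#{x ∈ A | x i = a} : ℝ) * #{y ∈ B | y i = b}
          = ∑ i, ∑ x ∈ A, ∑ y ∈ B,
              ((if x i = a then 1 else 0) * (if y i = b then 1 else 0) : ℝ) := by
            refine sum_congr rfl fun i _ => ?_
            rw [← sum_mul_sum]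
            simp
        _ = ∑ x ∈ A, ∑ y ∈ B, ∑ i,
              ((if x i = a then 1 else 0) * (if y i = b then 1 else 0) : ℝ) := by
            rw [sum_comm]
            exact sum_congr rfl fun x _ => sum_comm
        _ = #A * #B * (n * T (a, b)) := by
            rw [sum_congr rfl fun x hx => sum_congr rfl fun y hy => h1 x hx y hy]
            simp [mul_assoc]
    calc ∑ i, letterDist A i a * letterDist B i b
        = (∑ i, (#{x ∈ A | x i = a} : ℝ) * #{y ∈ B | y i = b}) / (#A * #B) := by
          rw [sum_div]
          refine sum_congr rfl fun i _ => ?_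
          simp only [letterDist]
          rw [div_mul_div_comm]
      _ = n * T (a, b) := by
          rw [hcount, mul_div_cancel_left₀ _ (mul_ne_zero hA' hB')]
  refine mem_regionStar_of_add hn hT
    (S := fun z => ∑ j ∈ J, letterDist A j z.1 * letterDist B j z.2)
    (S' := fun z => ∑ j ∈ Jᶜ, letterDist A j z.1 * letterDist B j z.2)
    (fun z => sum_nonneg fun j _ => mul_nonneg (letterDist_nonneg _ _ _) (letterDist_nonneg _ _ _))
    (fun z => sum_nonneg fun j _ => mul_nonneg (letterDist_nonneg _ _ _) (letterDist_nonneg _ _ _))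
    (fun z => ?_) ?_ ?_ ?_ ?_
  · rw [sum_add_sum_compl, hprod]
  · exact div_nonneg (Real.log_natCast_nonneg _) (Nat.cast_nonneg _)
  · exact div_nonneg (Real.log_natCast_nonneg _) (Nat.cast_nonneg _)
  · rw [mul_div_cancel₀ _ hn']
    exact (log_card_le_sum_entropy hA hJA).trans (sum_entropy_le_condEntropyXY J
      (letterDist_nonneg A) (sum_letterDist hA) (letterDist_nonneg B) (sum_letterDist hB))
  · rw [mul_div_cancel₀ _ hn', condEntropyYX_eq_swap]
    have hJB' : ∀ y ∈ B, ∀ y' ∈ B, (∀ j ∈ Jᶜ, y j = y' j) → y = y' := fun y hy y' hy' h =>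
      hJB y hy y' hy' fun j hj => h j (mem_compl.2 hj)
    refine (log_card_le_sum_entropy hB hJB').trans ((sum_entropy_le_condEntropyXY Jᶜ
      (letterDist_nonneg B) (sum_letterDist hB) (letterDist_nonneg A) (sum_letterDist hA)).trans_eq
      ?_)
    congr 1
    ext z
    exact sum_congr rfl fun j _ => mul_comm _ _

/-! ### Counting orbits of position permutations -/

open Classical in
/-- The labelling of positions by `f` inside `J` and by the positions themselves outside `J`. The
permutations preserving it fix every position outside `J` and preserve `f`. -/
def labelOn {ι : Type*} (J : Finset ι) (f : ι → Z) (i : ι) : Z ⊕ ι :=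
  if i ∈ J then Sum.inl (f i) else Sum.inr i

lemma labelOn_comp_eq_iff {ι : Type*} (J : Finset ι) (f : ι → Z) (π : Equiv.Perm ι) :
    labelOn J f ∘ π = labelOn J f ↔
      (∀ i ∈ J, π i ∈ J ∧ f (π i) = f i) ∧ ∀ i ∉ J, π i = i := by
  simp only [funext_iff, Function.comp_apply, labelOn]
  constructor
  · intro h
    refine ⟨fun i hi => ?_, fun i hi => ?_⟩
    · have := h i
      by_cases hπ : π i ∈ J <;> simp_all
    · have := h i
      by_cases hπ : π i ∈ J <;> simp_all
  · rintro ⟨h1, h2⟩ i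
    by_cases hi : i ∈ J
    · simp [hi, h1 i hi]
    · simp [hi, h2 i hi]

open Classical in
/-- The permutations of the positions that are the identity outside `J` and preserve `f`. -/
def permsOn {ι : Type*} [Fintype ι] (J : Finset ι) (f : ι → Z) : Finset (Equiv.Perm ι) :=
  {π | labelOn J f ∘ π = labelOn J f}

lemma mem_permsOn {ι : Type*} [Fintype ι] {J : Finset ι} {f : ι → Z} {π : Equiv.Perm ι} :
    π ∈ permsOn J f ↔ (∀ i ∈ J, π i ∈ J ∧ f (π i) = f i) ∧ ∀ i ∉ J, π i = i := by
  simp [permsOn, labelOn_comp_eq_iff]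

lemma card_permsOn {ι : Type*} [Fintype ι] [Fintype Z] [DecidableEq Z] (J : Finset ι) (f : ι → Z) :
    #(permsOn J f) = ∏ a, (#{j ∈ J | f j = a}).factorial := by
  classical
  rw [← Fintype.card_of_subtype (permsOn J f)
    (p := fun π : Equiv.Perm ι => labelOn J f ∘ π = labelOn J f) (fun π => by simp [permsOn]),
    DomMulAct.stabilizer_card, Fintype.prod_sum_type]
  have hout : ∀ i : ι, (Fintype.card {k // labelOn J f k = Sum.inr i}).factorial = 1 := by
    intro i
    rw [Nat.factorial_eq_one, Fintype.card_le_one_iff_subsingleton]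
    refine ⟨fun ⟨k, hk⟩ ⟨l, hl⟩ => Subtype.ext ?_⟩
    simp only [labelOn] at hk hl
    split_ifs at hk hl
    simp_all
  simp only [hout, prod_const_one, mul_one]
  simp only [Fintype.card_subtype]
  refine prod_congr rfl fun a _ => ?_
  congr 2
  ext j
  rw [mem_filter, mem_filter]
  by_cases hj : j ∈ J <;> simp [labelOn, hj]

open Classical in
/-- The sequences obtained from `x` by permuting letters at positions of `J` carrying the same
letter of `y`. -/
def orbitOn {ι : Type*} [Fintype ι] (J : Finset ι) (x : ι → X) (y : ι → Y) : Finset (ι → X) :=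
  (permsOn J y).image fun π : Equiv.Perm ι => x ∘ π

lemma orbitOn_nonempty {ι : Type*} [Fintype ι] (J : Finset ι) (x : ι → X) (y : ι → Y) :
    (orbitOn J x y).Nonempty := by
  classical
  exact ⟨x, mem_image.2 ⟨1, mem_permsOn.2 ⟨fun i hi => ⟨hi, rfl⟩, fun i _ => rfl⟩, rfl⟩⟩

/-- The orbit–stabiliser inequality for `orbitOn`. -/
lemma prod_factorial_le_card_orbitOn {ι : Type*} [Fintype ι] [Fintype X] [Fintype Y]
    [DecidableEq X] [DecidableEq Y] (J : Finset ι) (x : ι → X) (y : ι → Y) :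
    ∏ b, (#{j ∈ J | y j = b}).factorial ≤
      (∏ c, (#{j ∈ J | (x j, y j) = c}).factorial) * #(orbitOn J x y) := by
  classical
  have horb : orbitOn J x y = (permsOn J y).image fun π : Equiv.Perm ι => x ∘ π := by
    ext w; simp [orbitOn]
  rw [← card_permsOn J y, ← card_permsOn J fun j => (x j, y j), horb]
  refine card_le_mul_card_image _ _ fun w hw => ?_
  obtain ⟨π₀, hπ₀, rfl⟩ := mem_image.1 hw
  refine card_le_card_of_injOn (fun π => π * π₀⁻¹) (fun π hπ => ?_)
    (fun π _ π' _ h => mul_right_cancel h)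
  obtain ⟨hπ, hx⟩ := mem_filter.1 hπ
  have hlab : labelOn J y ∘ (π * π₀⁻¹ : Equiv.Perm ι) = labelOn J y := by
    simp only [permsOn, mem_filter, mem_univ, true_and] at hπ hπ₀
    ext i : 1
    have h1 := congrFun hπ (π₀⁻¹ i)
    have h2 := congrFun hπ₀ (π₀⁻¹ i)
    simp only [Function.comp_apply, Equiv.Perm.inv_def, Equiv.apply_symm_apply] at h1 h2
    simpa using h1.trans h2.symm
  have hx' : ∀ i, x ((π * π₀⁻¹ : Equiv.Perm ι) i) = x i := by
    intro i
    simpa using congrFun hx (π₀⁻¹ i)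
  rw [labelOn_comp_eq_iff] at hlab
  exact mem_permsOn.2 ⟨fun i hi => ⟨(hlab.1 i hi).1, by rw [hx', (hlab.1 i hi).2]⟩, hlab.2⟩

lemma empirical_comp_perm {n : ℕ} (z : Fin n → Z) (π : Equiv.Perm (Fin n)) :
    empirical n (z ∘ π) = empirical n z := by
  ext a
  simp only [empirical]
  rw [Nat.card_congr (π.subtypeEquiv fun i => Iff.rfl :
    {i // (z ∘ π) i = a} ≃ {i // z i = a})]

/-- Permuting `x` inside `J` along `y` and `y` outside `J` along `x` amounts to one permutation of
the pair sequence. Hence the two orbits form a biclique. -/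
lemma empirical_of_mem_orbitOn {n : ℕ} {J J' : Finset (Fin n)} (hJ : ∀ i, i ∈ J' ↔ i ∉ J)
    {x x' : Fin n → X} {y y' : Fin n → Y} (hx : x' ∈ orbitOn J x y) (hy : y' ∈ orbitOn J' y x) :
    empirical n (fun i => (x' i, y' i)) = empirical n fun i => (x i, y i) := by
  classical
  obtain ⟨π, hπ, rfl⟩ := mem_image.1 hx
  obtain ⟨σ, hσ, rfl⟩ := mem_image.1 hy
  rw [mem_permsOn] at hπ hσ
  rw [← empirical_comp_perm (fun i => (x i, y i)) (π * σ)]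
  congr 1
  ext i : 1
  by_cases hi : i ∈ J
  · have h1 : σ i = i := hσ.2 i (by simp [hJ, hi])
    simp [h1, (hπ.1 i hi).2]
  · have h1 := hσ.1 i ((hJ i).2 hi)
    have h2 : π i = i := hπ.2 i hi
    have h3 : π (σ i) = σ i := hπ.2 _ ((hJ _).1 h1.1)
    simp [h2, h3, h1.2]

lemma exists_subset_card_fiber_eq {ι : Type*} [Fintype ι] [Fintype Z] [DecidableEq Z]
    (z : ι → Z) (u : Z → ℕ)
    (hu : ∀ c, u c ≤ #{i | z i = c}) :
    ∃ J : Finset ι, ∀ c, #{j ∈ J | z j = c} = u c := by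
  classical
  choose S hS hSu using fun c => exists_subset_card_eq (hu c)
  refine ⟨univ.biUnion S, fun c => ?_⟩
  rw [← hSu c]
  congr 1
  ext j
  simp only [mem_filter, mem_biUnion, mem_univ, true_and]
  constructor
  · rintro ⟨⟨d, hd⟩, rfl⟩
    have : z j = d := by simpa using hS d hd
    rwa [this]
  · intro hj
    exact ⟨⟨c, hj⟩, by simpa using hS c hj⟩

/-! ### Factorials and rounding -/

lemma mul_log_sub_le_log_factorial (m : ℕ) :
    m * Real.log m - m ≤ Real.log (m.factorial) := by
  rcases Nat.eq_zero_or_pos m with rfl | hm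
  · simp
  have hm' : (0 : ℝ) < m := by positivity
  have h := Real.pow_div_factorial_le_exp (m : ℝ) hm'.le m
  have h2 := Real.log_le_log (by positivity) h
  rw [Real.log_exp, Real.log_div (by positivity) (by positivity), Real.log_pow] at h2
  linarith

lemma log_factorial_le {n m : ℕ} (hm : m ≤ n) :
    Real.log (m.factorial) ≤ m * Real.log m - m + (1 + Real.log n) := by
  have hlogn := Real.log_natCast_nonneg n
  rcases Nat.eq_zero_or_pos m with rfl | hm0
  · simp; linarith
  have key : Real.log (m.factorial) ≤ m * Real.log m - m + (1 + Real.log m) := by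
    clear hm
    induction m, hm0 using Nat.le_induction with
    | base => simp
    | succ m hm ih =>
      have hm' : (0 : ℝ) < m := by exact_mod_cast hm
      have h1 := Real.log_le_sub_one_of_pos (show (0 : ℝ) < m / (m + 1) by positivity)
      rw [Real.log_div (by positivity) (by positivity)] at h1
      have h2 := mul_le_mul_of_nonneg_left h1 (show (0 : ℝ) ≤ m + 1 by positivity)
      have h3 : ((m : ℝ) + 1) * (m / (m + 1) - 1) = -1 := by field_simp; ring
      rw [Nat.factorial_succ, Nat.cast_mul, Real.log_mul (by positivity) (by positivity)]
      push_cast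
      nlinarith
  have : Real.log m ≤ Real.log n :=
    Real.log_le_log (by exact_mod_cast hm0) (by exact_mod_cast hm)
  linarith

/-- The function `t ↦ t log t` has slope at most `1 + log n` on `[0, n]`. -/
lemma negMulLog_sub_le {s t N : ℝ} (hs : 0 ≤ s) (hst : s ≤ t) (ht : t ≤ N) :
    Real.negMulLog s - Real.negMulLog t ≤ (t - s) * (1 + Real.log N) := by
  rcases (hs.trans hst).eq_or_lt with h0 | h0
  · have : s = t := by linarith
    simp [this]
  have hlog : Real.log t ≤ Real.log N := Real.log_le_log h0 ht
  rcases hs.eq_or_lt with rfl | hs0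
  · simp only [Real.negMulLog]
    nlinarith
  · have h1 := Real.log_le_sub_one_of_pos (div_pos h0 hs0)
    rw [Real.log_div h0.ne' hs0.ne'] at h1
    have h2 := mul_le_mul_of_nonneg_left h1 hs
    have h3 : s * (t / s - 1) = t - s := by field_simp
    have h4 := mul_le_mul_of_nonneg_left hlog (sub_nonneg.2 hst)
    simp only [Real.negMulLog]
    nlinarith

lemma negMulLog_le_add_one {s t : ℝ} (hs : 0 ≤ s) (hst : s ≤ t) :
    Real.negMulLog t ≤ Real.negMulLog s + 1 := by
  rcases le_total s 1 with h1 | h1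
  · have h2 : 0 ≤ Real.negMulLog s := Real.negMulLog_nonneg hs h1
    have h3 : Real.negMulLog t ≤ 1 := by
      rcases (hs.trans hst).eq_or_lt with h0 | h0
      · simp [← h0]
      · have h4 := Real.one_sub_inv_le_log_of_pos h0
        have h5 := mul_le_mul_of_nonneg_left h4 h0.le
        rw [mul_sub, mul_inv_cancel₀ h0.ne'] at h5
        rw [Real.negMulLog]
        linarith
    linarith
  · have h2 : s * Real.log s ≤ t * Real.log t :=
      mul_le_mul hst (Real.log_le_log (by linarith) hst) (Real.log_nonneg h1) (by linarith)
    simp only [Real.negMulLog]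
    linarith

lemma margY_mono [Fintype X] {p u : X × Y → ℝ} (h : ∀ c, p c ≤ u c) (b : Y) :
    margY p b ≤ margY u b :=
  sum_le_sum fun _ _ => h _

lemma margY_nonneg [Fintype X] {p : X × Y → ℝ} (h : ∀ c, 0 ≤ p c) (b : Y) : 0 ≤ margY p b :=
  sum_nonneg fun _ _ => h _

lemma margY_le_add [Fintype X] {p u : X × Y → ℝ} (h : ∀ c, u c ≤ p c + 1) (b : Y) :
    margY u b ≤ margY p b + Fintype.card X := by
  calc margY u b ≤ ∑ x, (p (x, b) + 1) := sum_le_sum fun _ _ => h _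
    _ = margY p b + Fintype.card X := by simp [sum_add_distrib, margY]

/-- The conditional entropy hardly changes when a mass function is rounded, all entries down or all
entries up, by at most one. -/
lemma condEntropyXY_le_of_round [Fintype X] [Fintype Y] [Nonempty X] {N : ℝ} (hN : 1 ≤ N)
    {p u : X × Y → ℝ} (hp : ∀ c, 0 ≤ p c) (hu : ∀ c, 0 ≤ u c)
    (hpN : ∀ b, margY p b ≤ N) (huN : ∀ b, margY u b ≤ N)
    (h : (∀ c, u c ≤ p c ∧ p c ≤ u c + 1) ∨ ∀ c, p c ≤ u c ∧ u c ≤ p c + 1) :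
    condEntropyXY p ≤
      condEntropyXY u + Fintype.card X * Fintype.card Y * (2 + Real.log N) := by
  have hL : 0 ≤ Real.log N := Real.log_nonneg hN
  have hX : (1 : ℝ) ≤ Fintype.card X := by exact_mod_cast Fintype.card_pos
  suffices hb : ∀ b,
      (∑ x, Real.negMulLog (p (x, b))) - Real.negMulLog (margY p b) ≤
      (∑ x, Real.negMulLog (u (x, b))) - Real.negMulLog (margY u b) +
        Fintype.card X * (2 + Real.log N) by
    rw [condEntropyXY_eq_sum, condEntropyXY_eq_sum]
    refine (sum_le_sum fun b _ => hb b).trans_eq ?_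
    rw [sum_add_distrib, sum_const, card_univ, nsmul_eq_mul]
    ring
  intro b
  have hsum : ∀ {C : ℝ}, (∀ x, Real.negMulLog (p (x, b)) ≤ Real.negMulLog (u (x, b)) + C) →
      ∑ x, Real.negMulLog (p (x, b)) ≤
        ∑ x, Real.negMulLog (u (x, b)) + Fintype.card X * C := fun {C} hC =>
    (sum_le_sum fun x _ => hC x).trans_eq (by simp [sum_add_distrib])
  rcases h with h | h
  · have h1 := hsum (C := 1) fun x => negMulLog_le_add_one (hu _) (h _).1
    have h2 := negMulLog_sub_le (margY_nonneg hu b) (margY_mono (fun c => (h c).1) b) (hpN b)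
    have h3 := margY_le_add (fun c => (h c).2) b
    nlinarith
  · have h1 := hsum (C := 1 + Real.log N) fun x => by
      have hle : u (x, b) ≤ margY u b :=
        single_le_sum (f := fun x => u (x, b)) (fun x _ => hu _) (mem_univ x)
      have := negMulLog_sub_le (hp (x, b)) (h _).1 (hle.trans (huN b))
      have := (h (x, b)).2
      nlinarith
    have h2 := negMulLog_le_add_one (margY_nonneg hp b) (margY_mono (fun c => (h c).1) b)
    nlinarith

/-- If the pair sequence has, in the positions of `J`, letter counts that round `p`, then the
orbit of `x` has about `exp (condEntropyXY p)` elements. -/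
lemma condEntropyXY_le_log_card_orbitOn [Fintype X] [Fintype Y] [DecidableEq X] [DecidableEq Y]
    {n : ℕ} (hn : 1 ≤ n)
    (J : Finset (Fin n)) (x : Fin n → X) (y : Fin n → Y) {p : X × Y → ℝ} (hp : ∀ c, 0 ≤ p c)
    (hpn : ∀ b, margY p b ≤ n)
    (h : (∀ c, (#{j ∈ J | (x j, y j) = c} : ℝ) ≤ p c ∧
        p c ≤ (#{j ∈ J | (x j, y j) = c} : ℝ) + 1) ∨
      ∀ c, p c ≤ #{j ∈ J | (x j, y j) = c} ∧ (#{j ∈ J | (x j, y j) = c} : ℝ) ≤ p c + 1) :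
    condEntropyXY p ≤ Real.log #(orbitOn J x y) +
      Fintype.card X * Fintype.card Y * (3 + 2 * Real.log n) := by
  have hX : Nonempty X := ⟨x ⟨0, hn⟩⟩
  have hJn : ∀ (q : Fin n → Prop) [DecidablePred q], #{j ∈ J | q j} ≤ n := fun q _ => by
    simpa using card_le_univ {j ∈ J | q j}
  have hmarg : ∀ b, margY (fun c => (#{j ∈ J | (x j, y j) = c} : ℝ)) b =
      #{j ∈ J | y j = b} := by
    intro b
    simp only [margY, Prod.mk.injEq]
    rw [← Nat.cast_sum, card_eq_sum_card_fiberwise (f := x) (t := univ) (by simp)]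
    simp only [filter_filter, and_comm]
  have hround := condEntropyXY_le_of_round (N := n) (by exact_mod_cast hn) hp
    (u := fun c => (#{j ∈ J | (x j, y j) = c} : ℝ)) (fun c => Nat.cast_nonneg _) hpn
    (fun b => by rw [hmarg]; exact_mod_cast hJn _) h
  have horb : (0 : ℝ) < #(orbitOn J x y) := by
    exact_mod_cast (orbitOn_nonempty J x y).card_pos
  have hle : Real.log (∏ b, ((#{j ∈ J | y j = b}).factorial : ℝ)) ≤
      Real.log ((∏ c, ((#{j ∈ J | (x j, y j) = c}).factorial : ℝ)) * #(orbitOn J x y)) :=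
    Real.log_le_log (prod_pos fun b _ => by positivity)
      (by exact_mod_cast prod_factorial_le_card_orbitOn J x y)
  rw [Real.log_mul (prod_pos fun c _ => by positivity).ne' horb.ne',
    Real.log_prod fun b _ => by positivity, Real.log_prod fun c _ => by positivity] at hle
  have hlow := sum_le_sum fun b (_ : b ∈ univ) =>
    mul_log_sub_le_log_factorial #{j ∈ J | y j = b}
  have hupp := sum_le_sum fun c (_ : c ∈ univ) =>
    log_factorial_le (hJn fun j => (x j, y j) = c)
  have htot := sum_margY fun c => (#{j ∈ J | (x j, y j) = c} : ℝ)
  simp only [hmarg] at htot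
  rw [sum_sub_distrib] at hlow
  rw [sum_add_distrib, sum_sub_distrib, sum_const, card_univ, nsmul_eq_mul,
    Fintype.card_prod, Nat.cast_mul] at hupp
  have hH : condEntropyXY (fun c => (#{j ∈ J | (x j, y j) = c} : ℝ)) =
      ∑ b, (#{j ∈ J | y j = b} : ℝ) * Real.log #{j ∈ J | y j = b} -
      ∑ c, (#{j ∈ J | (x j, y j) = c} : ℝ) * Real.log #{j ∈ J | (x j, y j) = c} := by
    rw [condEntropyXY, entropy, entropy]
    simp only [hmarg, Real.negMulLog, neg_mul, sum_neg_distrib]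
    ring
  rw [hH] at hround
  linarith

/-- Achievability: every point of `R*(T)` is, up to an error of order `(log n) / n`, below the rate
pair of a biclique. -/
lemma exists_biclique [Fintype X] [Fintype Y] {n : ℕ} (hn : 1 ≤ n) {T : X × Y → ℝ}
    (hT : IsType n T) {R : ℝ × ℝ} (hR : R ∈ regionStar T) :
    ∃ (A : Finset (Fin n → X)) (B : Finset (Fin n → Y)), A.Nonempty ∧ B.Nonempty ∧
      (∀ x ∈ A, ∀ y ∈ B, empirical n (fun i => (x i, y i)) = T) ∧
      n * R.1 ≤ Real.log #A + Fintype.card X * Fintype.card Y * (3 + 2 * Real.log n) ∧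
      n * R.2 ≤ Real.log #B + Fintype.card X * Fintype.card Y * (3 + 2 * Real.log n) := by
  classical
  obtain ⟨-, -, α, hα0, hα1, P, hP, Q, hQ, hPQ, hR1, hR2⟩ := hR
  obtain ⟨z, hz⟩ := hT
  have hn' : (0 : ℝ) < n := by positivity
  have hβ : 0 ≤ 1 - α := by linarith
  set p : X × Y → ℝ := (n * α) • P with hp
  set q : X × Y → ℝ := (n * (1 - α)) • Q with hq
  have hp0 : ∀ c, 0 ≤ p c := fun c => mul_nonneg (by positivity) (hP.1 c)
  have hq0 : ∀ c, 0 ≤ q c := fun c => mul_nonneg (by positivity) (hQ.1 c)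
  have hpq : ∀ c, p c + q c = #{i | z i = c} := by
    intro c
    have h1 : p c + q c = n * (α • P + (1 - α) • Q) c := by simp [hp, hq]; ring
    rw [h1, hPQ, ← hz, empirical, mul_div_cancel₀ _ hn'.ne', Nat.card_eq_fintype_card,
      Fintype.card_subtype]
  have hpqn : ∑ c, p c + ∑ c, q c = n := by
    rw [← sum_add_distrib, sum_congr rfl fun c _ => hpq c, ← Nat.cast_sum,
      ← card_eq_sum_card_fiberwise (by simp)]
    simp
  obtain ⟨J, hJ⟩ := exists_subset_card_fiber_eq z (fun c => ⌊p c⌋₊) fun c => by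
    have := Nat.floor_le (hp0 c)
    have := hpq c
    have := hq0 c
    exact_mod_cast (by linarith : (⌊p c⌋₊ : ℝ) ≤ #{i | z i = c})
  have hJc : ∀ c, (#{j ∈ Jᶜ | z j = c} : ℝ) = p c + q c - ⌊p c⌋₊ := by
    intro c
    rw [hpq, ← hJ, eq_sub_iff_add_eq', ← Nat.cast_add, ← card_union_of_disjoint
      (disjoint_filter_filter disjoint_compl_right), ← filter_union, union_compl]
  set x : Fin n → X := fun i => (z i).1 with hx
  set y : Fin n → Y := fun i => (z i).2 with hy
  have hmargp : ∀ b, margY p b ≤ n := by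
    intro b
    have h1 := single_le_sum (f := margY p) (fun b _ => margY_nonneg hp0 b) (mem_univ b)
    rw [sum_margY] at h1
    linarith [sum_nonneg fun c (_ : c ∈ univ) => hq0 c]
  have hq0' : ∀ c, 0 ≤ (q ∘ Prod.swap) c := fun c => hq0 _
  have hmargq : ∀ a, margY (q ∘ Prod.swap) a ≤ n := by
    intro a
    have h1 := single_le_sum (f := margY (q ∘ Prod.swap)) (fun b _ => margY_nonneg hq0' b)
      (mem_univ a)
    have h2 : ∑ c, (q ∘ Prod.swap) c = ∑ c, q c := (Equiv.prodComm Y X).sum_comp q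
    rw [sum_margY, h2] at h1
    linarith [sum_nonneg fun c (_ : c ∈ univ) => hp0 c]
  have hXside := condEntropyXY_le_log_card_orbitOn hn J x y hp0 hmargp <| Or.inl fun c => by
    have h1 : (#{j ∈ J | (x j, y j) = c} : ℝ) = ⌊p c⌋₊ := by exact_mod_cast hJ c
    rw [h1]
    exact ⟨Nat.floor_le (hp0 c), (Nat.lt_floor_add_one _).le⟩
  have hYside := condEntropyXY_le_log_card_orbitOn hn Jᶜ y x hq0' hmargq <| Or.inr fun c => by
    have h1 : (#{j ∈ Jᶜ | (y j, x j) = c} : ℝ) = p c.swap + q c.swap - ⌊p c.swap⌋₊ := by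
      rw [← hJc]
      congr 2
      ext j
      simp [hx, hy, Prod.ext_iff, and_comm]
    rw [h1, Function.comp_apply]
    have := Nat.floor_le (hp0 c.swap)
    have := Nat.lt_floor_add_one (p c.swap)
    constructor <;> linarith
  refine ⟨orbitOn J x y, orbitOn Jᶜ y x, orbitOn_nonempty _ _ _, orbitOn_nonempty _ _ _,
    fun x' hx' y' hy' => ?_, le_trans ?_ hXside, le_trans ?_ (hYside.trans_eq ?_)⟩
  · rw [empirical_of_mem_orbitOn (fun i => mem_compl) hx' hy', ← hz]
  · rw [hp, condEntropyXY_smul, mul_assoc]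
    exact mul_le_mul_of_nonneg_left hR1 hn'.le
  · rw [← condEntropyYX_eq_swap, hq, condEntropyYX_smul, mul_assoc]
    exact mul_le_mul_of_nonneg_left hR2 hn'.le
  · ring

variable [Fintype X] [Fintype Y]

/-! ### Bicliques and the rate region -/

lemma density_eq_one_iff {n : ℕ} {T : X × Y → ℝ} {A : Finset (Fin n → X)}
    {B : Finset (Fin n → Y)} (hA : A.Nonempty) (hB : B.Nonempty) :
    density n T A B = 1 ↔ ∀ x ∈ A, ∀ y ∈ B, empirical n (fun i => (x i, y i)) = T := by
  classical
  have hA' : (#A : ℝ) ≠ 0 := by positivity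
  have hB' : (#B : ℝ) ≠ 0 := by positivity
  rw [density, div_eq_one_iff_eq (mul_ne_zero hA' hB'), ← Nat.cast_mul, Nat.cast_inj,
    ← card_product, card_filter_eq_iff]
  simp only [Adj, mem_typeClass, mem_product, Prod.forall]
  exact ⟨fun h x hx y hy => h x y ⟨hx, hy⟩, fun h x y hxy => h x hxy.1 y hxy.2⟩

lemma density_le_one {n : ℕ} (T : X × Y → ℝ) (A : Finset (Fin n → X)) (B : Finset (Fin n → Y)) :
    density n T A B ≤ 1 := by
  classical
  refine div_le_one_of_le₀ ?_ (by positivity)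
  rw [← Nat.cast_mul, ← card_product]
  exact_mod_cast card_filter_le _ _

/-- Sub-bicliques of a biclique realise all smaller pairs of sizes. -/
lemma mem_bicliqueRegion_of_biclique {n : ℕ} {T : X × Y → ℝ} {A : Finset (Fin n → X)}
    {B : Finset (Fin n → Y)} (hAB : ∀ x ∈ A, ∀ y ∈ B, empirical n (fun i => (x i, y i)) = T)
    {M₁ M₂ : ℕ} (h1 : 1 ≤ M₁) (h1' : M₁ ≤ #A) (h2 : 1 ≤ M₂) (h2' : M₂ ≤ #B) :
    (Real.log M₁ / n, Real.log M₂ / n) ∈ bicliqueRegion n T := by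
  obtain ⟨A', hA', rfl⟩ := exists_subset_card_eq h1'
  obtain ⟨B', hB', rfl⟩ := exists_subset_card_eq h2'
  have hAn : A'.Nonempty := card_pos.1 h1
  have hBn : B'.Nonempty := card_pos.1 h2
  have hAB' : ∀ x ∈ A', ∀ y ∈ B', empirical n (fun i => (x i, y i)) = T :=
    fun x hx y hy => hAB x (hA' hx) y (hB' hy)
  have hAT : A' ⊆ typeClass n (margX T) := fun x hx => by
    obtain ⟨y, hy⟩ := hBn
    rw [mem_typeClass, ← hAB' x hx y hy]
    exact empirical_fst x y
  have hBT : B' ⊆ typeClass n (margY T) := fun y hy => by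
    obtain ⟨x, hx⟩ := hAn
    rw [mem_typeClass, ← hAB' x hx y hy]
    exact empirical_snd x y
  refine ⟨#A', #B', h1, card_le_card hAT, h2, card_le_card hBT, rfl, ?_⟩
  refine IsGreatest.csSup_eq ⟨⟨A', hAT, B', hBT, rfl, rfl, (density_eq_one_iff hAn hBn).2 hAB'⟩, ?_⟩
  rintro ρ ⟨A, -, B, -, -, -, rfl⟩
  exact density_le_one T A B

lemma bicliqueRegion_subset_regionStar {n : ℕ} (hn : 1 ≤ n) (T : X × Y → ℝ) :
    bicliqueRegion n T ⊆ regionStar T := by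
  classical
  rintro _ ⟨M₁, M₂, h1, h1', h2, h2', rfl, hmax⟩
  -- the supremum runs over a finite nonempty set, so it is attained
  let S : Set ℝ := {ρ | ∃ A ⊆ typeClass n (margX T), ∃ B ⊆ typeClass n (margY T),
    #A = M₁ ∧ #B = M₂ ∧ density n T A B = ρ}
  have hfin : S.Finite := by
    refine (((typeClass n (margX T)).powerset ×ˢ (typeClass n (margY T)).powerset).image
      fun p => density n T p.1 p.2).finite_toSet.subset ?_
    rintro ρ ⟨A, hA, B, hB, -, -, rfl⟩
    simp only [coe_image, Set.mem_image, mem_coe, mem_product, mem_powerset]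
    exact ⟨(A, B), ⟨hA, hB⟩, rfl⟩
  obtain ⟨A₀, hA₀, hA₀'⟩ := exists_subset_card_eq h1'
  obtain ⟨B₀, hB₀, hB₀'⟩ := exists_subset_card_eq h2'
  have hmem : maxDensity n T M₁ M₂ ∈ S :=
    Set.Nonempty.csSup_mem ⟨_, A₀, hA₀, B₀, hB₀, hA₀', hB₀', rfl⟩ hfin
  rw [hmax] at hmem
  obtain ⟨A, -, B, -, rfl, rfl, hd⟩ := hmem
  have hA : A.Nonempty := card_pos.1 h1
  have hB : B.Nonempty := card_pos.1 h2
  exact biclique_mem_regionStar hn hA hB ((density_eq_one_iff hA hB).1 hd)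

lemma bicliqueRegion_subset_rates (n : ℕ) (T : X × Y → ℝ) :
    bicliqueRegion n T ⊆ rates n (margX T) ×ˢ rates n (margY T) := by
  rintro _ ⟨M₁, M₂, h1, h1', h2, h2', rfl, -⟩
  exact ⟨⟨M₁, h1, h1', rfl⟩, ⟨M₂, h2, h2', rfl⟩⟩

/-! ### The bound with explicit margins -/

/-- The margin absorbs the loss of the achievability bound, because `16 e³ ≤ 8³`. -/
lemma loss_le_margin {n a b c : ℝ} (ha : 0 ≤ a) (hb : 0 ≤ b) (hn : 8 ≤ n) (hc : 0 < c)
    (hcn : 512 * c ≤ n ^ 3) :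
    a * b * (3 + 2 * Real.log n) ≤ n * (a * b / n * Real.log (n ^ 4 * (n + 1) / (16 * c))) := by
  have hn0 : 0 < n := by linarith
  have h1 : n * (a * b / n * Real.log (n ^ 4 * (n + 1) / (16 * c))) =
      a * b * Real.log (n ^ 4 * (n + 1) / (16 * c)) := by field_simp
  rw [h1]
  refine mul_le_mul_of_nonneg_left ?_ (mul_nonneg ha hb)
  rw [Real.le_log_iff_exp_le (by positivity), Real.exp_add, le_div_iff₀ (by positivity),
    show Real.exp (2 * Real.log n) = n ^ 2 by
      rw [two_mul, Real.exp_add, Real.exp_log hn0, sq]]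
  have he : Real.exp 3 ≤ 32 := by
    have h2 := Real.exp_one_lt_d9.le
    calc Real.exp 3 = Real.exp 1 ^ 3 := by rw [← Real.exp_nat_mul]; norm_num
      _ ≤ 2.7182818286 ^ 3 := pow_le_pow_left₀ (Real.exp_pos _).le h2 3
      _ ≤ 32 := by norm_num
  calc Real.exp 3 * n ^ 2 * (16 * c) ≤ 32 * n ^ 2 * (16 * c) := by gcongr
    _ = n ^ 2 * (512 * c) := by ring
    _ ≤ n ^ 2 * n ^ 3 := by gcongr
    _ ≤ n ^ 4 * (n + 1) := by nlinarith [pow_pos hn0 4]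

/-- The condition on `n` used in `loss_le_margin`, for both margins. -/
lemma size_bounds {n a b : ℝ} (ha : 1 ≤ a) (hb : 1 ≤ b)
    (h : 8 * (a * b) ^ (7 / 5 : ℝ) ≤ n) : 8 ≤ n ∧ 512 * a ≤ n ^ 3 ∧ 512 * b ^ 2 ≤ n ^ 3 := by
  have hab : 1 ≤ a * b := by nlinarith
  have h1 : a * b ≤ (a * b) ^ (7 / 5 : ℝ) := by
    simpa using Real.rpow_le_rpow_of_exponent_le hab (show (1 : ℝ) ≤ 7 / 5 by norm_num)
  have h2 : 8 * (a * b) ≤ n := by linarith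
  have h3 : (8 * (a * b)) ^ 3 ≤ n ^ 3 := pow_le_pow_left₀ (by positivity) h2 3
  have h4 : (a * b) ^ 1 ≤ (a * b) ^ 3 := pow_le_pow_right₀ hab (by norm_num)
  have h5 : (a * b) ^ 2 ≤ (a * b) ^ 3 := pow_le_pow_right₀ hab (by norm_num)
  have h6 : b ^ 2 ≤ (a * b) ^ 2 := pow_le_pow_left₀ (by positivity) (by nlinarith) 2
  exact ⟨by linarith, by nlinarith, by nlinarith⟩

lemma inner_bound {n : ℕ} (hn : 1 ≤ n) {T : X × Y → ℝ} (hT : IsType n T)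
    (h : 8 * ((Fintype.card X : ℝ) * (Fintype.card Y : ℝ)) ^ (7 / 5 : ℝ) ≤ (n : ℝ)) :
    minkowskiDiff (regionStar T)
        (Set.Icc 0 (eps₁ (Fintype.card X) (Fintype.card Y) n) ×ˢ
          Set.Icc 0 (eps₂ (Fintype.card X) (Fintype.card Y) n)) ∩
      (rates n (margX T) ×ˢ rates n (margY T)) ⊆ bicliqueRegion n T := by
  rintro ⟨R₁, R₂⟩ ⟨hR, ⟨M₁, h1, -, hM₁⟩, ⟨M₂, h2, -, hM₂⟩⟩
  simp only at hM₁ hM₂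
  subst hM₁ hM₂
  have hn' : (0 : ℝ) < n := by positivity
  obtain ⟨z, -⟩ := id hT
  have hX : (1 : ℝ) ≤ Fintype.card X := by
    exact_mod_cast Fintype.card_pos_iff.2 ⟨(z ⟨0, hn⟩).1⟩
  have hY : (1 : ℝ) ≤ Fintype.card Y := by
    exact_mod_cast Fintype.card_pos_iff.2 ⟨(z ⟨0, hn⟩).2⟩
  obtain ⟨h8, hXn, hYn⟩ := size_bounds hX hY h
  have hloss₁ := loss_le_margin (a := Fintype.card X) (b := Fintype.card Y) (by positivity)
    (by positivity) h8 (by positivity) hXn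
  have hloss₂ := loss_le_margin (a := Fintype.card X) (b := Fintype.card Y) (by positivity)
    (by positivity) h8 (by positivity) hYn
  have hlogn : 0 ≤ (Fintype.card X : ℝ) * Fintype.card Y * (3 + 2 * Real.log n) := by
    have := Real.log_natCast_nonneg n
    positivity
  have hε₁ : 0 ≤ eps₁ (Fintype.card X) (Fintype.card Y) n :=
    nonneg_of_mul_nonneg_right (hlogn.trans hloss₁) hn'
  have hε₂ : 0 ≤ eps₂ (Fintype.card X) (Fintype.card Y) n :=
    nonneg_of_mul_nonneg_right (hlogn.trans hloss₂) hn'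
  have hcorner := Set.mem_iInter₂.1 hR
    (eps₁ (Fintype.card X) (Fintype.card Y) n, eps₂ (Fintype.card X) (Fintype.card Y) n)
    ⟨⟨hε₁, le_rfl⟩, ⟨hε₂, le_rfl⟩⟩
  obtain ⟨A, B, hA, hB, hAB, hlA, hlB⟩ := exists_biclique hn hT hcorner
  simp only [Prod.mk_add_mk, mul_add, mul_div_cancel₀ _ hn'.ne'] at hlA hlB
  have hA' : (0 : ℝ) < #A := by positivity
  have hB' : (0 : ℝ) < #B := by positivity
  have hM₁ : (0 : ℝ) < M₁ := by positivity
  have hM₂ : (0 : ℝ) < M₂ := by positivity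
  rw [eps₁] at hlA
  rw [eps₂] at hlB
  refine mem_bicliqueRegion_of_biclique hAB h1 ?_ h2 ?_
  · exact_mod_cast (Real.log_le_log_iff hM₁ hA').1 (by linarith)
  · exact_mod_cast (Real.log_le_log_iff hM₂ hB').1 (by linarith)

/-! ### The asymptotic region -/

lemma IsType.mul {n : ℕ} {T : Z → ℝ} (hT : IsType n T) {k : ℕ} (hk : 1 ≤ k) :
    IsType (k * n) T := by
  obtain ⟨z, rfl⟩ := hT
  refine ⟨fun i => z i.modNat, ?_⟩
  ext a
  have h : Nat.card {i : Fin (k * n) // z i.modNat = a} = k * Nat.card {i : Fin n // z i = a} := by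
    have e : {i : Fin (k * n) // z i.modNat = a} ≃ {p : Fin k × Fin n // z p.2 = a} :=
      finProdFinEquiv.symm.subtypeEquiv fun i => Iff.rfl
    have e' : {p : Fin k × Fin n // z p.2 = a} ≃ Fin k × {i : Fin n // z i = a} :=
      ⟨fun p => (p.1.1, ⟨p.1.2, p.2⟩), fun p => ⟨(p.1, p.2.1), p.2.2⟩, fun _ => rfl, fun _ => rfl⟩
    rw [Nat.card_congr (e.trans e'), Nat.card_prod, Nat.card_fin]
  have hk' : (k : ℝ) ≠ 0 := by positivity
  simp only [empirical, h]
  push_cast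
  exact mul_div_mul_left _ _ hk'

lemma continuous_entropy : Continuous (entropy : (X → ℝ) → ℝ) :=
  continuous_finsetSum _ fun a _ => Real.continuous_negMulLog.comp (continuous_apply a)

lemma continuous_condEntropyXY : Continuous (condEntropyXY : (X × Y → ℝ) → ℝ) :=
  continuous_entropy.sub (continuous_entropy.comp (by unfold margY; fun_prop))

lemma continuous_condEntropyYX : Continuous (condEntropyYX : (X × Y → ℝ) → ℝ) :=
  continuous_entropy.sub (continuous_entropy.comp (by unfold margX; fun_prop))

/-- `R*(T)` is closed: it is the projection of a closed set along the compact set of all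
parameters `(α, P, Q)`. -/
lemma isClosed_regionStar (T : X × Y → ℝ) : IsClosed (regionStar T) := by
  have : CompactSpace (stdSimplex ℝ (X × Y)) :=
    isCompact_iff_compactSpace.1 (isCompact_stdSimplex ℝ (X × Y))
  let F : Set ((ℝ × ℝ) × Set.Icc (0 : ℝ) 1 × stdSimplex ℝ (X × Y) × stdSimplex ℝ (X × Y)) :=
    {w | 0 ≤ w.1.1 ∧ 0 ≤ w.1.2 ∧
    (w.2.1 : ℝ) • (w.2.2.1 : X × Y → ℝ) + (1 - (w.2.1 : ℝ)) • (w.2.2.2 : X × Y → ℝ) = T ∧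
    w.1.1 ≤ w.2.1 * condEntropyXY (w.2.2.1 : X × Y → ℝ) ∧
    w.1.2 ≤ (1 - w.2.1) * condEntropyYX (w.2.2.2 : X × Y → ℝ)}
  have hXY := continuous_condEntropyXY (X := X) (Y := Y)
  have hYX := continuous_condEntropyYX (X := X) (Y := Y)
  have hF : IsClosed F := by
    simp only [F, Set.ofPred_and]
    exact (isClosed_le (by fun_prop) (by fun_prop)).inter
      ((isClosed_le (by fun_prop) (by fun_prop)).inter
      ((isClosed_eq (by fun_prop) (by fun_prop)).inter
      ((isClosed_le (by fun_prop) (by fun_prop)).inter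
      (isClosed_le (by fun_prop) (by fun_prop)))))
  have hproj : regionStar T = Prod.fst '' F := by
    ext R
    constructor
    · rintro ⟨h1, h2, α, hα0, hα1, P, hP, Q, hQ, h⟩
      exact ⟨(R, ⟨α, hα0, hα1⟩, ⟨P, hP⟩, ⟨Q, hQ⟩), ⟨h1, h2, h⟩, rfl⟩
    · rintro ⟨⟨R', ⟨α, hα0, hα1⟩, ⟨P, hP⟩, ⟨Q, hQ⟩⟩, ⟨h1, h2, h⟩, rfl⟩
      exact ⟨h1, h2, α, hα0, hα1, P, hP, Q, hQ, h⟩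
  rw [hproj]
  exact isClosedMap_fst_of_compactSpace _ hF

/-- A rate `R` that is at most `(log N) / m` up to a small loss is approximated by a rate
`(log M) / m` with `M ≤ N`. -/
lemma exists_log_near {N : ℕ} (hN : 1 ≤ N) {R m L : ℝ} (hm : 0 < m) (hR : 0 ≤ R) (hL : 0 ≤ L)
    (h : m * R ≤ Real.log N + L) :
    ∃ M : ℕ, 1 ≤ M ∧ M ≤ N ∧ |Real.log M / m - R| ≤ (L + 1) / m := by
  have hexp : 1 ≤ Real.exp (m * R) := Real.one_le_exp (by positivity)
  have hfl : 1 ≤ ⌊Real.exp (m * R)⌋₊ := Nat.le_floor (by simpa using hexp)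
  have key : ∀ M : ℕ, Real.log M ≤ m * R → m * R ≤ Real.log M + (L + 1) →
      |Real.log M / m - R| ≤ (L + 1) / m := by
    intro M h1 h2
    have h3 : Real.log M / m - R = (Real.log M - m * R) / m := by field_simp
    rw [h3, abs_div, abs_of_pos hm]
    gcongr
    rw [abs_le]
    constructor <;> linarith
  have hfl0 : (0 : ℝ) < ⌊Real.exp (m * R)⌋₊ := by exact_mod_cast hfl
  have hflog : Real.log ⌊Real.exp (m * R)⌋₊ ≤ m * R :=
    (Real.log_le_iff_le_exp hfl0).2 (Nat.floor_le (Real.exp_pos _).le)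
  rcases le_total N ⌊Real.exp (m * R)⌋₊ with hle | hle
  · refine ⟨N, hN, le_rfl, key N (le_trans ?_ hflog) (by linarith)⟩
    exact Real.log_le_log (by exact_mod_cast hN) (by exact_mod_cast hle)
  · refine ⟨_, hfl, hle, key _ hflog ?_⟩
    -- `exp (m R) < ⌊exp (m R)⌋ + 1 ≤ 2 ⌊exp (m R)⌋ ≤ e ⌊exp (m R)⌋`
    have h1 := Nat.lt_floor_add_one (Real.exp (m * R))
    have h2 : (1 : ℝ) ≤ ⌊Real.exp (m * R)⌋₊ := by exact_mod_cast hfl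
    have h3 : Real.exp (m * R) ≤ ⌊Real.exp (m * R)⌋₊ * Real.exp 1 := by
      have := Real.add_one_le_exp (1 : ℝ)
      nlinarith
    have h4 := Real.log_le_log (Real.exp_pos _) h3
    rw [Real.log_exp, Real.log_mul hfl0.ne' (Real.exp_pos _).ne', Real.log_exp] at h4
    linarith

lemma tendsto_loss_div (C : ℝ) {n : ℕ} (hn : 1 ≤ n) :
    Filter.Tendsto (fun k : ℕ => (C * (3 + 2 * Real.log ((k * n : ℕ) : ℝ)) + 1) / ((k * n : ℕ) : ℝ))
      Filter.atTop (nhds 0) := by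
  have hk : Filter.Tendsto (fun k : ℕ => ((k * n : ℕ) : ℝ)) Filter.atTop Filter.atTop :=
    tendsto_natCast_atTop_atTop.comp (Filter.tendsto_id.atTop_mul_const' (by omega))
  have h1 : Filter.Tendsto (fun t : ℝ => (C * (3 + 2 * Real.log t) + 1) / t)
      Filter.atTop (nhds 0) := by
    have hlog := Real.isLittleO_log_id_atTop.tendsto_div_nhds_zero
    have hinv := tendsto_inv_atTop_zero (𝕜 := ℝ)
    have := (hinv.const_mul (3 * C + 1)).add (hlog.const_mul (2 * C))
    simp only [mul_zero, add_zero, id] at this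
    refine this.congr fun t => ?_
    ring
  exact h1.comp hk

lemma asympBicliqueRegion_eq_regionStar {n : ℕ} (hn : 1 ≤ n) {T : X × Y → ℝ} (hT : IsType n T) :
    asympBicliqueRegion n T = regionStar T := by
  refine Set.Subset.antisymm ?_ fun R hR => ?_
  · refine closure_minimal (Set.iUnion₂_subset fun k hk => ?_) (isClosed_regionStar T)
    exact bicliqueRegion_subset_regionStar (Nat.mul_pos hk hn) T
  rw [asympBicliqueRegion, Metric.mem_closure_iff]
  intro ε hε
  obtain ⟨k, hkε, hk⟩ := (((tendsto_loss_div (Fintype.card X * Fintype.card Y) hn).eventually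
    (gt_mem_nhds hε)).and (Filter.eventually_ge_atTop 1)).exists
  have hm : 1 ≤ k * n := Nat.mul_pos hk hn
  obtain ⟨A, B, hA, hB, hAB, hlA, hlB⟩ := exists_biclique hm (hT.mul hk) hR
  have hL : 0 ≤ (Fintype.card X : ℝ) * Fintype.card Y * (3 + 2 * Real.log ((k * n : ℕ) : ℝ)) := by
    have := Real.log_natCast_nonneg (k * n)
    positivity
  have hm' : (0 : ℝ) < ((k * n : ℕ) : ℝ) := by exact_mod_cast hm
  obtain ⟨M₁, h1, h1', hd1⟩ := exists_log_near hA.card_pos hm' hR.1 hL hlA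
  obtain ⟨M₂, h2, h2', hd2⟩ := exists_log_near hB.card_pos hm' hR.2.1 hL hlB
  refine ⟨_, Set.mem_iUnion₂.2 ⟨k, hk, mem_bicliqueRegion_of_biclique hAB h1 h1' h2 h2'⟩, ?_⟩
  rw [dist_comm, Prod.dist_eq, max_lt_iff, Real.dist_eq, Real.dist_eq]
  exact ⟨hd1.trans_lt hkε, hd2.trans_lt hkε⟩

end

end TypeGraph

theorem theorem2 {X Y : Type*} [Fintype X] [Fintype Y] (n : ℕ) (hn : 1 ≤ n)
    (T : X × Y → ℝ) (hT : TypeGraph.IsType n T) :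
    (8 * ((Fintype.card X : ℝ) * (Fintype.card Y : ℝ)) ^ (7 / 5 : ℝ) ≤ (n : ℝ) →
      TypeGraph.minkowskiDiff (TypeGraph.regionStar T)
            (Set.Icc 0 (TypeGraph.eps₁ (Fintype.card X) (Fintype.card Y) n) ×ˢ
              Set.Icc 0 (TypeGraph.eps₂ (Fintype.card X) (Fintype.card Y) n)) ∩
          (TypeGraph.rates n (TypeGraph.margX T) ×ˢ TypeGraph.rates n (TypeGraph.margY T))
        ⊆ TypeGraph.bicliqueRegion n T ∧
      TypeGraph.bicliqueRegion n T ⊆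
        TypeGraph.regionStar T ∩
          (TypeGraph.rates n (TypeGraph.margX T) ×ˢ TypeGraph.rates n (TypeGraph.margY T))) ∧
    TypeGraph.asympBicliqueRegion n T = TypeGraph.regionStar T :=
  ⟨fun h => ⟨TypeGraph.inner_bound hn hT h, Set.subset_inter
      (TypeGraph.bicliqueRegion_subset_regionStar hn T)
      (TypeGraph.bicliqueRegion_subset_rates n T)⟩,
    TypeGraph.asympBicliqueRegion_eq_regionStar hn hT⟩
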